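/- Let $H$ be a real Hilbert space and let $\pi:\mathbb{Z}\to\mathcal{O}(H)$ be an orthogonal representation of $\mathbb{Z}$ on $H$. Let $H_{\mathbb{C}}$ be the complexification of $H$, let $\mathcal{F}=\mathbb{C}\Omega\oplus\bigoplus_{n\ge 1}H_{\mathbb{C}}^{\otimes n}$ be its full Fock space, and for $\xi\in H$ put $s(\xi)=\ell(\xi)+\ell(\xi)^*$, where $\ell(\xi)$ is the left creation operator on $\mathcal{F}$ given by $\xi$. Let $\Gamma(H)''\subset B(\mathcal{F})$ be the von Neumann algebra generated by $\{s(\xi):\xi\in H\}$. The free Bogoljubov action of $\mathbb{Z}$ on $\Gamma(H)''$ is the action $\alpha$ determined by $\alpha_g(s(\xi))=s(\pi(g)\xi)$; it is implemented by the unitaries $\bigoplus_{n\ge 0}\pi_{\mathbb{C}}(g)^{\otimes n}$, where $\pi_{\mathbb{C}}$ is the complexification of $\pi$. Let $M_\pi=\Gamma(H)''\rtimes_\alpha\mathbb{Z}$ be the von Neumann algebraic crossed product. Then $M_\pi$ is a factor (that is, its centre is $\mathbb{C}1$) if and only if $\pi$ is faithful (that is, injective). -/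

import Mathlib

open scoped TensorProduct ENNReal ComplexConjugate

noncomputable section

universe u v

namespace FreeBogoljubov

/-! ### Complexification of a real Hilbert space -/

section Complexification

/-- The complexification `H_ℂ = H ⊕ iH` of a real Hilbert space; the pair `(a, b)` stands for
`a + i b`, and `‖a + i b‖² = ‖a‖² + ‖b‖²`. -/
def Complexification (H : Type u) : Type u := WithLp 2 (H × H)

namespace Complexification

section Basic

variable {H : Type u}

/-- The vector `a + i b` of `H_ℂ`. -/
def mk (a b : H) : Complexification H := WithLp.toLp 2 (a, b)

/-- The real part `a` of `a + i b`. -/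
def re (x : Complexification H) : H := WithLp.fst (p := 2) (α := H) (β := H) x

/-- The imaginary part `b` of `a + i b`. -/
def im (x : Complexification H) : H := WithLp.snd (p := 2) (α := H) (β := H) x

theorem ext {x y : Complexification H} (h₁ : re x = re y) (h₂ : im x = im y) : x = y :=
  WithLp.ofLp_injective 2 (Prod.ext h₁ h₂)

@[simp] theorem re_mk (a b : H) : re (mk a b) = a := rfl
@[simp] theorem im_mk (a b : H) : im (mk a b) = b := rfl

variable [NormedAddCommGroup H]

instance : NormedAddCommGroup (Complexification H) :=
  inferInstanceAs (NormedAddCommGroup (WithLp 2 (H × H)))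

instance [CompleteSpace H] : CompleteSpace (Complexification H) :=
  inferInstanceAs (CompleteSpace (WithLp 2 (H × H)))

@[simp] theorem re_add (x y : Complexification H) : re (x + y) = re x + re y := rfl
@[simp] theorem im_add (x y : Complexification H) : im (x + y) = im x + im y := rfl
@[simp] theorem re_zero : re (0 : Complexification H) = 0 := rfl
@[simp] theorem im_zero : im (0 : Complexification H) = 0 := rfl

theorem norm_sq (x : Complexification H) : ‖x‖ ^ 2 = ‖re x‖ ^ 2 + ‖im x‖ ^ 2 :=
  WithLp.prod_norm_sq_eq_of_L2 (α := H) (β := H) x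

end Basic

variable {H : Type u} [NormedAddCommGroup H] [InnerProductSpace ℝ H]

/-- `(r + i s)(a + i b) = (r a - s b) + i (s a + r b)`. -/
instance : SMul ℂ (Complexification H) :=
  ⟨fun z x => mk (z.re • re x - z.im • im x) (z.im • re x + z.re • im x)⟩

@[simp] theorem re_smul (z : ℂ) (x : Complexification H) :
    re (z • x) = z.re • re x - z.im • im x := rfl
@[simp] theorem im_smul (z : ℂ) (x : Complexification H) :
    im (z • x) = z.im • re x + z.re • im x := rfl

instance : Module ℂ (Complexification H) where
  one_smul x := ext (by simp) (by simp)
  mul_smul z w x := by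
    apply ext
    · simp only [re_smul, im_smul, Complex.mul_re, Complex.mul_im]; module
    · simp only [re_smul, im_smul, Complex.mul_re, Complex.mul_im]; module
  smul_zero z := ext (by simp) (by simp)
  smul_add z x y := by
    apply ext
    · simp only [re_smul, re_add, im_add]; module
    · simp only [im_smul, re_add, im_add]; module
  add_smul z w x := by
    apply ext
    · simp only [re_smul, re_add, Complex.add_re, Complex.add_im]; module
    · simp only [im_smul, im_add, Complex.add_re, Complex.add_im]; module
  zero_smul x := ext (by simp) (by simp)

/-- The sesquilinear extension (conjugate-linear in the first variable) of the real inner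
product. -/
instance : Inner ℂ (Complexification H) :=
  ⟨fun x y => ⟨inner ℝ (re x) (re y) + inner ℝ (im x) (im y),
    inner ℝ (re x) (im y) - inner ℝ (im x) (re y)⟩⟩

theorem inner_def (x y : Complexification H) : inner ℂ x y =
    ⟨inner ℝ (re x) (re y) + inner ℝ (im x) (im y),
      inner ℝ (re x) (im y) - inner ℝ (im x) (re y)⟩ := rfl

theorem norm_smul_sq (z : ℂ) (x : Complexification H) : ‖z • x‖ ^ 2 = (‖z‖ * ‖x‖) ^ 2 := by
  rw [mul_pow, norm_sq, norm_sq, re_smul, im_smul, norm_sub_sq_real, norm_add_sq_real,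
    Complex.sq_norm, Complex.normSq_apply]
  simp only [norm_smul, inner_smul_left, inner_smul_right, mul_pow, Real.norm_eq_abs, sq_abs,
    conj_trivial]
  ring

instance : NormedSpace ℂ (Complexification H) where
  norm_smul_le z x :=
    le_of_eq ((sq_eq_sq₀ (norm_nonneg _) (by positivity)).1 (norm_smul_sq z x))

instance : InnerProductSpace ℂ (Complexification H) where
  norm_sq_eq_re_inner x := by
    simp [inner_def, norm_sq]
  conj_inner_symm x y := by
    apply Complex.ext <;> simp [inner_def, real_inner_comm]
  add_left x y z := by
    apply Complex.ext
    · simp only [inner_def, re_add, im_add, inner_add_left, Complex.add_re]; ring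
    · simp only [inner_def, re_add, im_add, inner_add_left, Complex.add_im]; ring
  smul_left x y z := by
    apply Complex.ext
    · simp only [inner_def, re_smul, im_smul, inner_add_left, inner_sub_left, inner_smul_left,
        Complex.mul_re, Complex.conj_re, Complex.conj_im, conj_trivial]; ring
    · simp only [inner_def, re_smul, im_smul, inner_add_left, inner_sub_left, inner_smul_left,
        Complex.mul_im, Complex.conj_re, Complex.conj_im, conj_trivial]; ring

/-- The canonical embedding `H ⊂ H_ℂ`. -/
def ofReal (ξ : H) : Complexification H := mk ξ 0

/-- The complexification `U_ℂ (a + i b) = U a + i U b` of an orthogonal operator. -/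
def map (U : H ≃ₗᵢ[ℝ] H) : Complexification H ≃ₗᵢ[ℂ] Complexification H where
  toFun x := mk (U (re x)) (U (im x))
  invFun x := mk (U.symm (re x)) (U.symm (im x))
  left_inv x := ext (by simp) (by simp)
  right_inv x := ext (by simp) (by simp)
  map_add' x y := ext (by simp) (by simp)
  map_smul' z x := ext (by simp) (by simp)
  norm_map' x := (sq_eq_sq₀ (norm_nonneg _) (norm_nonneg _)).1 (by
    rw [norm_sq, norm_sq]
    change ‖U (re x)‖ ^ 2 + ‖U (im x)‖ ^ 2 = _
    simp)

theorem map_ofReal (U : H ≃ₗᵢ[ℝ] H) (ξ : H) : map U (ofReal ξ) = ofReal (U ξ) :=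
  ext rfl (map_zero U)

/-- `U ↦ U_ℂ` as a homomorphism from the orthogonal group of `H` to the unitary group of `H_ℂ`. -/
def mapHom : (H ≃ₗᵢ[ℝ] H) →* (Complexification H ≃ₗᵢ[ℂ] Complexification H) where
  toFun := map
  map_one' := LinearIsometryEquiv.ext fun _ => rfl
  map_mul' _ _ := LinearIsometryEquiv.ext fun _ => rfl

end Complexification

end Complexification

/-! ### The full Fock space -/

section Fock

/-- A complex inner product space, bundled. -/
structure PreHilbert : Type (u + 1) where
  carrier : Type u
  [normed : NormedAddCommGroup carrier]
  [innerSpace : InnerProductSpace ℂ carrier]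

attribute [instance] PreHilbert.normed PreHilbert.innerSpace

variable (E : Type u) [NormedAddCommGroup E] [InnerProductSpace ℂ E]

/-- The algebraic tensor powers with their inner products: the power `0` is the one-dimensional
space `ℂ` (placed in the universe of `E`), and the power `n + 1` is `E ⊗ E^{⊗ n}`. -/
def algPower : ℕ → PreHilbert.{u}
  | 0 => ⟨EuclideanSpace ℂ PUnit.{u + 1}⟩
  | n + 1 => ⟨E ⊗[ℂ] (algPower n).carrier⟩

/-- The algebraic tensor power `E^{⊗_alg n}`. -/
abbrev AlgPower (n : ℕ) : Type u := (algPower E n).carrier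

/-- The Hilbert space tensor power `E^{⊗ n}`. -/
abbrev HilbertPower (n : ℕ) : Type u := UniformSpace.Completion (AlgPower E n)

/-- The full Fock space `⨁_{n ≥ 0} E^{⊗ n}` (`ℓ²`-direct sum), where `E^{⊗ 0} = ℂ Ω`. -/
abbrev Fock : Type u := lp (HilbertPower E) 2

variable {E}

/-- The unit `1 ∈ ℂ = E^{⊗ 0}`. -/
def algVacuum : AlgPower E 0 := (EuclideanSpace.single PUnit.unit 1 : EuclideanSpace ℂ PUnit)

/-- The vacuum vector `Ω`. -/
def vacuum : Fock E := lp.single 2 0 ((algVacuum : AlgPower E 0) : HilbertPower E 0)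

/-- `x ↦ ξ ⊗ x`, from `E^{⊗_alg n}` to `E^{⊗_alg (n + 1)}`. -/
def algCons (ξ : E) (n : ℕ) : AlgPower E n →L[ℂ] AlgPower E (n + 1) :=
  TensorProduct.mkL ℂ E (AlgPower E n) ξ

theorem algPower_succ_induction {n : ℕ} {p : AlgPower E (n + 1) → Prop} (zero : p 0)
    (cons : ∀ ξ x, p (algCons ξ n x)) (add : ∀ x y, p x → p y → p (x + y))
    (x : AlgPower E (n + 1)) : p x :=
  TensorProduct.induction_on (R := ℂ) (M := E) (N := AlgPower E n) (motive := p) x zero cons add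

theorem norm_algCons (ξ : E) (n : ℕ) (x : AlgPower E n) : ‖algCons ξ n x‖ = ‖ξ‖ * ‖x‖ :=
  TensorProduct.norm_tmul (𝕜 := ℂ) ξ x

/-- The `n`-fold tensor power of a unitary, on `E^{⊗_alg n}`. -/
def algMap (U : E ≃ₗᵢ[ℂ] E) : (n : ℕ) → (AlgPower E n ≃ₗᵢ[ℂ] AlgPower E n)
  | 0 => LinearIsometryEquiv.refl ℂ (AlgPower E 0)
  | n + 1 => (TensorProduct.congrIsometry U (algMap U n) :
      (E ⊗[ℂ] AlgPower E n) ≃ₗᵢ[ℂ] (E ⊗[ℂ] AlgPower E n))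

theorem algMap_algCons (U : E ≃ₗᵢ[ℂ] E) (ξ : E) (n : ℕ) (x : AlgPower E n) :
    algMap U (n + 1) (algCons ξ n x) = algCons (U ξ) n (algMap U n x) := rfl

theorem algMap_one (n : ℕ) (x : AlgPower E n) : algMap (1 : E ≃ₗᵢ[ℂ] E) n x = x := by
  induction n with
  | zero => rfl
  | succ n ih =>
    have h : algMap (1 : E ≃ₗᵢ[ℂ] E) n = LinearIsometryEquiv.refl ℂ _ :=
      LinearIsometryEquiv.ext ih
    change TensorProduct.congrIsometry (LinearIsometryEquiv.refl ℂ E) (algMap 1 n) _ = _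
    rw [h, TensorProduct.congrIsometry_refl_refl]
    rfl

theorem algMap_mul (U V : E ≃ₗᵢ[ℂ] E) (n : ℕ) (x : AlgPower E n) :
    algMap (U * V) n x = algMap U n (algMap V n x) := by
  induction n with
  | zero => rfl
  | succ n ih =>
    induction x using algPower_succ_induction with
    | zero => simp only [map_zero]
    | cons ξ y =>
      rw [algMap_algCons, algMap_algCons, algMap_algCons, ih]
      rfl
    | add x y hx hy => rw [map_add, map_add, map_add, hx, hy]

variable {F F' : Type*} [NormedAddCommGroup F] [NormedSpace ℂ F]
  [NormedAddCommGroup F'] [NormedSpace ℂ F']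

/-- The extension of a bounded operator to the completions. -/
def complMap (f : F →L[ℂ] F') :
    UniformSpace.Completion F →L[ℂ] UniformSpace.Completion F' where
  toFun := UniformSpace.Completion.map f
  map_add' x y := by
    induction x, y using UniformSpace.Completion.induction_on₂ with
    | hp =>
      exact isClosed_eq (UniformSpace.Completion.continuous_map.comp continuous_add)
        (continuous_add.comp ((UniformSpace.Completion.continuous_map.comp continuous_fst).prodMk
          (UniformSpace.Completion.continuous_map.comp continuous_snd)))
    | ih x y =>
      rw [← UniformSpace.Completion.coe_add, UniformSpace.Completion.map_coe f.uniformContinuous,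
        UniformSpace.Completion.map_coe f.uniformContinuous,
        UniformSpace.Completion.map_coe f.uniformContinuous, map_add,
        UniformSpace.Completion.coe_add]
  map_smul' c x := by
    induction x using UniformSpace.Completion.induction_on with
    | hp =>
      exact isClosed_eq (UniformSpace.Completion.continuous_map.comp (continuous_const_smul c))
        ((continuous_const_smul c).comp UniformSpace.Completion.continuous_map)
    | ih x =>
      rw [← UniformSpace.Completion.coe_smul, UniformSpace.Completion.map_coe f.uniformContinuous,
        UniformSpace.Completion.map_coe f.uniformContinuous, map_smul,
        UniformSpace.Completion.coe_smul]
      rfl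
  cont := UniformSpace.Completion.continuous_map

@[simp] theorem complMap_coe (f : F →L[ℂ] F') (x : F) :
    complMap f (x : UniformSpace.Completion F) = (f x : UniformSpace.Completion F') :=
  UniformSpace.Completion.map_coe f.uniformContinuous x

theorem norm_complMap_apply (f : F →L[ℂ] F') (C : ℝ) (h : ∀ x, ‖f x‖ = C * ‖x‖)
    (x : UniformSpace.Completion F) : ‖complMap f x‖ = C * ‖x‖ := by
  induction x using UniformSpace.Completion.induction_on with
  | hp => exact isClosed_eq (by fun_prop) (by fun_prop)
  | ih x => rw [complMap_coe, UniformSpace.Completion.norm_coe, UniformSpace.Completion.norm_coe, h]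

/-- `x ↦ ξ ⊗ x`, from `E^{⊗ n}` to `E^{⊗ (n + 1)}`. -/
def cons (ξ : E) (n : ℕ) : HilbertPower E n →L[ℂ] HilbertPower E (n + 1) :=
  complMap (algCons ξ n)

theorem norm_cons (ξ : E) (n : ℕ) (x : HilbertPower E n) : ‖cons ξ n x‖ = ‖ξ‖ * ‖x‖ :=
  norm_complMap_apply _ _ (norm_algCons ξ n) x

/-- The `n`-fold tensor power of a unitary, on `E^{⊗ n}`. -/
def powerMap (U : E ≃ₗᵢ[ℂ] E) (n : ℕ) : HilbertPower E n →L[ℂ] HilbertPower E n :=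
  complMap ((algMap U n).toContinuousLinearEquiv : AlgPower E n →L[ℂ] AlgPower E n)

theorem norm_powerMap (U : E ≃ₗᵢ[ℂ] E) (n : ℕ) (x : HilbertPower E n) :
    ‖powerMap U n x‖ = ‖x‖ := by
  rw [powerMap, norm_complMap_apply _ 1 (fun y => ?_) x, one_mul]
  rw [one_mul]
  exact (algMap U n).norm_map y

theorem powerMap_coe (U : E ≃ₗᵢ[ℂ] E) (n : ℕ) (x : AlgPower E n) :
    powerMap U n (x : HilbertPower E n) = (algMap U n x : HilbertPower E n) :=
  complMap_coe _ x

theorem powerMap_one (n : ℕ) (x : HilbertPower E n) : powerMap (1 : E ≃ₗᵢ[ℂ] E) n x = x := by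
  induction x using UniformSpace.Completion.induction_on with
  | hp => exact isClosed_eq (by fun_prop) (by fun_prop)
  | ih x => rw [powerMap_coe, algMap_one]

theorem powerMap_mul (U V : E ≃ₗᵢ[ℂ] E) (n : ℕ) (x : HilbertPower E n) :
    powerMap (U * V) n x = powerMap U n (powerMap V n x) := by
  induction x using UniformSpace.Completion.induction_on with
  | hp => exact isClosed_eq (by fun_prop) (by fun_prop)
  | ih x => rw [powerMap_coe, powerMap_coe, powerMap_coe, algMap_mul]

theorem powerMap_cons (U : E ≃ₗᵢ[ℂ] E) (ξ : E) (n : ℕ) (x : HilbertPower E n) :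
    powerMap U (n + 1) (cons ξ n x) = cons (U ξ) n (powerMap U n x) := by
  induction x using UniformSpace.Completion.induction_on with
  | hp => exact isClosed_eq (by fun_prop) (by fun_prop)
  | ih x => rw [cons, cons, complMap_coe, powerMap_coe, powerMap_coe, complMap_coe, algMap_algCons]

/-- The components of `ℓ(ξ) f`: the component in degree `0` vanishes, and the component in
degree `n + 1` is `ξ ⊗ f n`. -/
def creationFun (ξ : E) (f : (n : ℕ) → HilbertPower E n) : (n : ℕ) → HilbertPower E n
  | 0 => 0
  | n + 1 => cons ξ n (f n)

theorem hasSum_creationFun (ξ : E) (f : Fock E) :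
    HasSum (fun n => ‖creationFun ξ f n‖ ^ (2 : ℝ≥0∞).toReal)
      ((‖ξ‖ * ‖f‖) ^ (2 : ℝ≥0∞).toReal) := by
  have h := (lp.hasSum_norm (p := 2) (by norm_num) f).mul_left (‖ξ‖ ^ (2 : ℝ≥0∞).toReal)
  rw [← Real.mul_rpow (norm_nonneg _) (norm_nonneg _)] at h
  rw [hasSum_nat_add_iff' 1 |>.symm]
  simpa [creationFun, norm_cons, mul_pow] using h

/-- The left creation operator `ℓ(ξ)`: `ℓ(ξ) Ω = ξ` and
`ℓ(ξ)(ξ₁ ⊗ ⋯ ⊗ ξₙ) = ξ ⊗ ξ₁ ⊗ ⋯ ⊗ ξₙ`. -/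
def creation (ξ : E) : Fock E →L[ℂ] Fock E :=
  LinearMap.mkContinuous
    { toFun := fun f => ⟨creationFun ξ f, memℓp_gen (hasSum_creationFun ξ f).summable⟩
      map_add' := fun f g => by
        apply lp.ext
        funext n
        cases n with
        | zero => exact (add_zero _).symm
        | succ n => exact map_add (cons ξ n) _ _
      map_smul' := fun c f => by
        apply lp.ext
        funext n
        cases n with
        | zero => exact (smul_zero c).symm
        | succ n => exact map_smul (cons ξ n) c _ }
    ‖ξ‖ (fun f => by
      refine le_of_eq ?_
      have h := (lp.hasSum_norm (p := 2) (by norm_num)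
        (⟨creationFun ξ f, memℓp_gen (hasSum_creationFun ξ f).summable⟩ : Fock E)).unique
          (hasSum_creationFun ξ f)
      exact (Real.rpow_left_inj (norm_nonneg _) (by positivity) (by norm_num)).1 h)

/-- The second quantisation `⨁ₙ U^{⊗ n}` of a unitary `U`, on the full Fock space. -/
def fockMap (U : E ≃ₗᵢ[ℂ] E) : Fock E ≃ₗᵢ[ℂ] Fock E where
  toFun f := ⟨fun n => powerMap U n (f n), (lp.memℓp f).mono' fun n => (norm_powerMap U n _).le⟩
  invFun f := ⟨fun n => powerMap U⁻¹ n (f n),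
    (lp.memℓp f).mono' fun n => (norm_powerMap U⁻¹ n _).le⟩
  left_inv f := lp.ext (funext fun n => by
    change powerMap U⁻¹ n (powerMap U n (f n)) = f n
    rw [← powerMap_mul, inv_mul_cancel, powerMap_one])
  right_inv f := lp.ext (funext fun n => by
    change powerMap U n (powerMap U⁻¹ n (f n)) = f n
    rw [← powerMap_mul, mul_inv_cancel, powerMap_one])
  map_add' f g := lp.ext (funext fun n => map_add (powerMap U n) _ _)
  map_smul' c f := lp.ext (funext fun n => map_smul (powerMap U n) c _)
  norm_map' f := by
    rw [lp.norm_eq_tsum_rpow (by norm_num), lp.norm_eq_tsum_rpow (by norm_num)]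
    change (∑' n, ‖powerMap U n (f n)‖ ^ (2 : ℝ≥0∞).toReal) ^ _ = _
    simp only [norm_powerMap]

/-- `U ↦ ⨁ₙ U^{⊗ n}` as a homomorphism of unitary groups. -/
def fockHom : (E ≃ₗᵢ[ℂ] E) →* (Fock E ≃ₗᵢ[ℂ] Fock E) where
  toFun := fockMap
  map_one' := LinearIsometryEquiv.ext fun f => lp.ext (funext fun n => powerMap_one n (f n))
  map_mul' U V :=
    LinearIsometryEquiv.ext fun f => lp.ext (funext fun n => powerMap_mul U V n (f n))

theorem fockMap_creation (U : E ≃ₗᵢ[ℂ] E) (ξ : E) (f : Fock E) :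
    fockMap U (creation ξ f) = creation (U ξ) (fockMap U f) := by
  apply lp.ext
  funext n
  cases n with
  | zero => exact map_zero (powerMap U 0)
  | succ n => exact powerMap_cons U ξ n (f n)

end Fock

/-! ### Von Neumann algebras -/

section VonNeumann

variable {K : Type v} [NormedAddCommGroup K] [InnerProductSpace ℂ K] [CompleteSpace K]

/-- The von Neumann algebra `S''` generated by a set `S` of bounded operators: the bicommutant
of `S ∪ S*`. -/
def vonNeumannGenerated (S : Set (K →L[ℂ] K)) : VonNeumannAlgebra K where
  toStarSubalgebra := StarSubalgebra.centralizer ℂ (StarSubalgebra.centralizer ℂ S : Set (K →L[ℂ] K))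
  centralizer_centralizer' := by
    change Set.centralizer (Set.centralizer
      (StarSubalgebra.centralizer ℂ (StarSubalgebra.centralizer ℂ S : Set (K →L[ℂ] K)) : Set (K →L[ℂ] K))) =
      (StarSubalgebra.centralizer ℂ (StarSubalgebra.centralizer ℂ S : Set (K →L[ℂ] K)) : Set (K →L[ℂ] K))
    rw [StarSubalgebra.coe_centralizer_centralizer, Set.centralizer_centralizer_centralizer]

/-- A von Neumann algebra `N` is a factor if its centre `N ∩ N'` consists of the scalars. -/
def IsFactor (N : VonNeumannAlgebra K) : Prop :=
  ∀ x ∈ N, x ∈ N.commutant → ∃ c : ℂ, x = c • (1 : K →L[ℂ] K)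

/-- A unitarily implemented action `α_g = Ad u_g` of a discrete group `G` on a von Neumann
algebra `N`. -/
structure SpatialAction (G : Type*) [Group G] (N : VonNeumannAlgebra K) where
  /-- The implementing unitary representation. -/
  implementing : G →* (K ≃ₗᵢ[ℂ] K)
  conj_mem : ∀ g, ∀ x ∈ N, (implementing g).conjStarAlgEquiv x ∈ N

variable {G : Type*} [Group G]

/-- The automorphism `α_g(x) = u_g x u_g*`. -/
def SpatialAction.act {N : VonNeumannAlgebra K} (α : SpatialAction G N) (g : G)
    (x : K →L[ℂ] K) : K →L[ℂ] K :=
  (α.implementing g).conjStarAlgEquiv x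

theorem SpatialAction.norm_act_le {N : VonNeumannAlgebra K} (α : SpatialAction G N) (g : G)
    (x : K →L[ℂ] K) : ‖α.act g x‖ ≤ ‖x‖ := by
  refine ContinuousLinearMap.opNorm_le_bound _ (norm_nonneg _) fun v => ?_
  have h : α.act g x v = α.implementing g (x ((α.implementing g).symm v)) := rfl
  rw [h, LinearIsometryEquiv.norm_map]
  simpa using x.le_opNorm ((α.implementing g).symm v)

/-- The operator `(π_α(x) f)(k) = α_{k⁻¹}(x) f(k)` on `ℓ²(G, K)`. -/
def SpatialAction.embed {N : VonNeumannAlgebra K} (α : SpatialAction G N) (x : K →L[ℂ] K) :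
    lp (fun _ : G => K) 2 →L[ℂ] lp (fun _ : G => K) 2 :=
  lp.mapCLM 2 (fun k : G => α.act k⁻¹ x) (norm_nonneg x) fun k => α.norm_act_le k⁻¹ x

/-- The left translation `(λ_g f)(k) = f(g⁻¹ k)` on `ℓ²(G, K)`. -/
def leftTranslation (K : Type v) [NormedAddCommGroup K] [InnerProductSpace ℂ K] (g : G) :
    lp (fun _ : G => K) 2 →L[ℂ] lp (fun _ : G => K) 2 :=
  LinearIsometry.toContinuousLinearMap
    { toFun := fun f => ⟨fun k => f (g⁻¹ * k), memℓp_gen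
        ((Equiv.mulLeft g⁻¹).summable_iff.2 ((lp.memℓp f).summable (by norm_num)))⟩
      map_add' := fun _ _ => rfl
      map_smul' := fun _ _ => rfl
      norm_map' := fun f => by
        rw [lp.norm_eq_tsum_rpow (by norm_num), lp.norm_eq_tsum_rpow (by norm_num)]
        exact congrArg (· ^ _) ((Equiv.mulLeft g⁻¹).tsum_eq
          (fun k => ‖f k‖ ^ (2 : ℝ≥0∞).toReal)) }

/-- The crossed product `N ⋊_α G`: the von Neumann algebra on `ℓ²(G, K)` generated by `π_α(N)`
and the left translations. -/
def crossedProduct {N : VonNeumannAlgebra K} (α : SpatialAction G N) :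
    VonNeumannAlgebra (lp (fun _ : G => K) 2) :=
  vonNeumannGenerated (α.embed '' (N : Set (K →L[ℂ] K)) ∪ Set.range (leftTranslation (G := G) K))

theorem conj_add_star (u : K ≃ₗᵢ[ℂ] K) (x : K →L[ℂ] K) :
    u.conjStarAlgEquiv (x + star x) = u.conjStarAlgEquiv x + star (u.conjStarAlgEquiv x) := by
  rw [map_add, map_star]

theorem conj_mem_vonNeumannGenerated {S : Set (K →L[ℂ] K)} (u : K ≃ₗᵢ[ℂ] K)
    (h : ∀ s ∈ S, u.conjStarAlgEquiv s ∈ S) {x : K →L[ℂ] K} (hx : x ∈ vonNeumannGenerated S) :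
    u.conjStarAlgEquiv x ∈ vonNeumannGenerated S := by
  have key : ∀ y ∈ StarSubalgebra.centralizer ℂ S,
      u.conjStarAlgEquiv.symm y ∈ StarSubalgebra.centralizer ℂ S := by
    intro y hy
    rw [StarSubalgebra.mem_centralizer_iff] at hy ⊢
    intro s hs
    obtain ⟨h₁, h₂⟩ := hy _ (h s hs)
    constructor
    · apply EquivLike.injective u.conjStarAlgEquiv
      rw [map_mul, map_mul, StarAlgEquiv.apply_symm_apply, h₁]
    · apply EquivLike.injective u.conjStarAlgEquiv
      rw [map_mul, map_mul, StarAlgEquiv.apply_symm_apply, map_star, h₂]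
  change u.conjStarAlgEquiv x ∈
    StarSubalgebra.centralizer ℂ (StarSubalgebra.centralizer ℂ S : Set (K →L[ℂ] K))
  replace hx : x ∈
    StarSubalgebra.centralizer ℂ (StarSubalgebra.centralizer ℂ S : Set (K →L[ℂ] K)) := hx
  rw [StarSubalgebra.mem_centralizer_iff] at hx ⊢
  intro y hy
  obtain ⟨h₁, h₂⟩ := hx _ (key y hy)
  constructor
  · apply EquivLike.injective u.conjStarAlgEquiv.symm
    rw [map_mul, map_mul, StarAlgEquiv.symm_apply_apply, h₁]
  · apply EquivLike.injective u.conjStarAlgEquiv.symm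
    rw [map_mul, map_mul, StarAlgEquiv.symm_apply_apply, map_star, h₂]

end VonNeumann

/-! ### Free Bogoljubov crossed products -/

section FreeBogoljubov

variable {H : Type u} [NormedAddCommGroup H] [InnerProductSpace ℝ H]

/-- The semicircular operator `s(ξ) = ℓ(ξ) + ℓ(ξ)*` on the full Fock space of `H_ℂ`, for a
vector `ξ` of the real Hilbert space `H`. -/
def semicircular (ξ : H) : Fock (Complexification H) →L[ℂ] Fock (Complexification H) :=
  creation (Complexification.ofReal ξ) + star (creation (Complexification.ofReal ξ))

/-- The von Neumann algebra `Γ(H)''` of the free Gaussian functor. -/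
def gaussianAlgebra (H : Type u) [NormedAddCommGroup H] [InnerProductSpace ℝ H] :
    VonNeumannAlgebra (Fock (Complexification H)) :=
  vonNeumannGenerated (Set.range (semicircular (H := H)))

theorem conj_semicircular (U : H ≃ₗᵢ[ℝ] H) (ξ : H) :
    (fockMap (Complexification.map U)).conjStarAlgEquiv (semicircular ξ) =
      semicircular (U ξ) := by
  have h : (fockMap (Complexification.map U)).conjStarAlgEquiv
      (creation (Complexification.ofReal ξ)) = creation (Complexification.ofReal (U ξ)) := by
    refine ContinuousLinearMap.ext fun f => ?_
    change fockMap (Complexification.map U) (creation (Complexification.ofReal ξ)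
      ((fockMap (Complexification.map U)).symm f)) = _
    rw [fockMap_creation, LinearIsometryEquiv.apply_symm_apply, Complexification.map_ofReal]
  rw [semicircular, semicircular, ← h]
  generalize fockMap (Complexification.map U) = V
  exact conj_add_star V _

variable {G : Type*} [Group G]

/-- The free Bogoljubov action of `G` on `Γ(H)''` associated with an orthogonal representation
`π` of `G` on `H`; it is implemented by the second quantisation of `π_ℂ` and satisfies
`α_g(s(ξ)) = s(π(g) ξ)`. -/
def bogoljubovAction (π : G →* (H ≃ₗᵢ[ℝ] H)) : SpatialAction G (gaussianAlgebra H) where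
  implementing := fockHom.comp (Complexification.mapHom.comp π)
  conj_mem g _ hx := conj_mem_vonNeumannGenerated _
    (by rintro _ ⟨ξ, rfl⟩; exact ⟨π g ξ, (conj_semicircular (π g) ξ).symm⟩) hx

theorem bogoljubovAction_semicircular (π : G →* (H ≃ₗᵢ[ℝ] H)) (g : G) (ξ : H) :
    (bogoljubovAction π).act g (semicircular ξ) = semicircular (π g ξ) :=
  conj_semicircular (π g) ξ

/-- The free Bogoljubov crossed product `M_π = Γ(H, G, π)'' = Γ(H)'' ⋊ G`. -/
def freeBogoljubovCrossedProduct (π : G →* (H ≃ₗᵢ[ℝ] H)) :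
    VonNeumannAlgebra (lp (fun _ : G => Fock (Complexification H)) 2) :=
  crossedProduct (bogoljubovAction π)

end FreeBogoljubov

end FreeBogoljubov

end

/-!
The crossed product `M_π` acts on `ℓ²(G, 𝓕)`, where `𝓕` is the full Fock space of `H_ℂ`, and
`δ₁ ⊗ Ω` is a cyclic vector for it.

If `π g = 1` with `g ≠ 1`, then the translation `λ_g` is a nonscalar central unitary, the group
being commutative (`implementing_injective_of_isFactor`).

Conversely let `π` be injective, let `x` be central in `M_π`, and let `η_k ∈ 𝓕` be the components
of `x (δ₁ ⊗ Ω)`. Besides the left operators `s(ξ)` there are the right semicircular operators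
`d(ξ) = r(ξ) + r(ξ)*`, where `r(ξ)` appends `ξ` on the right; they commute with `Γ(H)''`, so
`1 ⊗ d(ξ)` commutes with `M_π`. Since `s(ξ) Ω = d(ξ) Ω`, moving these operators through `x` gives

  `s(π(k⁻¹) ξ) η_k = d(ξ) η_k` for all unit vectors `ξ ∈ H`   (`semicircular_apply_eq_of_central`).

Two commuting isometries `L`, `R` with `(L*)ⁿ → 0` strongly have the property that
`(L + L*) η = (R + R*) η` forces `L η = R η` (`intertwiner_of_semicircular_eq`): the vector
`θ = L η - R η = R* η - L* η` is fixed by `L* R*`, hence `θ = (R*)ⁿ (L*)ⁿ θ → 0`. Thus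
`ℓ(ξ') η = r(ξ) η` for `ξ' = π(k⁻¹) ξ` and `η = η_k`. Together with the commutation relation
`ℓ(ξ')* r(ξ) = r(ξ) ℓ(ξ')* + ⟨ξ', ξ⟩ P_Ω` this yields:

* if `ξ' ≠ ξ`, then `η ⊥ Ω` (`inner_vacuum_eq_zero`);
* if `η ⊥ Ω`, then `η = ℓ(ξ') ℓ(ξ')* η` (`creation_star_creation_eq_self`).

The second identity for two orthogonal unit vectors forces `η = 0`
(`eq_zero_of_forall_semicircular_eq`). Such a pair exists since `π(1)² ≠ 1` excludes `dim H ≤ 1`.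
For `k ≠ 1` this gives `η_k = 0`; for `k = 1` it applies to `η₁ - ⟨Ω, η₁⟩ Ω`. Hence
`x (δ₁ ⊗ Ω)` is a multiple of `δ₁ ⊗ Ω`, and `x` is a scalar by cyclicity
(`eq_smul_one_of_apply_single_vacuum`).
-/

noncomputable section

universe u v

namespace FreeBogoljubov

open Filter Topology

/-! ### Commuting isometries -/

section Isometries

variable {K : Type v} [NormedAddCommGroup K] [InnerProductSpace ℂ K] [CompleteSpace K]

theorem norm_star_pow_apply_le {L : K →L[ℂ] K} (hL : star L * L = 1) (n : ℕ) (v : K) :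
    ‖(star L ^ n) v‖ ≤ ‖v‖ := by
  have hL1 : ‖star L‖ ≤ 1 := by
    rw [norm_star]
    refine L.opNorm_le_bound zero_le_one fun v => ?_
    rw [(ContinuousLinearMap.norm_map_iff_adjoint_comp_self L).2 hL v, one_mul]
  induction n with
  | zero => exact le_rfl
  | succ n ih =>
    rw [pow_succ']
    exact ((star L).le_opNorm _).trans
      ((mul_le_of_le_one_left (norm_nonneg _) hL1).trans ih)

/-- A vector on which `L + L*` and `R + R*` agree is one on which `L` and `R` agree, for commuting
isometries `L` and `R` with `(L*)ⁿ → 0` strongly. The vector `L η - R η = R* η - L* η` is fixed by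
`R* L*`, hence equal to `(R*)ⁿ (L*)ⁿ (L η - R η)`, which tends to `0`. -/
theorem intertwiner_of_semicircular_eq {L R : K →L[ℂ] K} (hL : star L * L = 1)
    (hR : star R * R = 1) (hLR : L * R = R * L)
    (hpure : ∀ v, Tendsto (fun n : ℕ => ((star L) ^ n) v) atTop (𝓝 0)) {η : K}
    (h : (L + star L) η = (R + star R) η) : L η = R η := by
  have hθ : L η - R η = star R η - star L η := by
    rw [sub_eq_sub_iff_add_eq_add]
    simpa [add_comm] using h
  have hcomm : Commute (star R) (star L) := by
    change star R * star L = star L * star R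
    rw [← star_mul, ← star_mul, hLR]
  have hfix : (star R * star L) (L η - R η) = L η - R η := by
    have h1 : (star R * star L) (L η) = star R η := by
      have := congrArg (fun T : K →L[ℂ] K => T η)
        (show star R * star L * L = star R by rw [mul_assoc, hL, mul_one])
      exact this
    have h2 : (star R * star L) (R η) = star L η := by
      have := congrArg (fun T : K →L[ℂ] K => T η)
        (show star R * star L * R = star L by rw [hcomm.eq, mul_assoc, hR, mul_one])
      exact this
    rw [map_sub, h1, h2, hθ]
  have hiter : ∀ n : ℕ, (star R ^ n) ((star L ^ n) (L η - R η)) = L η - R η := by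
    intro n
    change (star R ^ n * star L ^ n) _ = _
    rw [← hcomm.mul_pow]
    induction n with
    | zero => rfl
    | succ n ih =>
      rw [pow_succ]
      change ((star R * star L) ^ n) ((star R * star L) _) = _
      rw [hfix, ih]
  have hlim : Tendsto (fun n : ℕ => ‖(star L ^ n) (L η - R η)‖) atTop (𝓝 0) := by
    simpa using (hpure (L η - R η)).norm
  have hle : ‖L η - R η‖ ≤ 0 := by
    refine ge_of_tendsto' hlim fun n => ?_
    conv_lhs => rw [← hiter n]
    exact norm_star_pow_apply_le hR n _
  exact sub_eq_zero.1 (norm_le_zero_iff.1 hle)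

end Isometries

/-! ### Crossed products by spatial actions -/

section CrossedProduct

variable {K : Type v} [NormedAddCommGroup K] [InnerProductSpace ℂ K] [CompleteSpace K]

theorem subset_vonNeumannGenerated {S : Set (K →L[ℂ] K)} {s : K →L[ℂ] K} (hs : s ∈ S) :
    s ∈ vonNeumannGenerated S := by
  change s ∈ StarSubalgebra.centralizer ℂ (StarSubalgebra.centralizer ℂ S : Set (K →L[ℂ] K))
  rw [StarSubalgebra.mem_centralizer_iff]
  intro y hy
  have h := (StarSubalgebra.mem_centralizer_iff ℂ).1
    (show y ∈ StarSubalgebra.centralizer ℂ S from hy)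
  refine ⟨((h s hs).1).symm, ?_⟩
  have h2 := congrArg star (h s hs).2
  simpa only [star_mul, star_star] using h2

theorem mul_comm_of_mem_vonNeumannGenerated {S : Set (K →L[ℂ] K)} {b x : K →L[ℂ] K}
    (hb : ∀ s ∈ S, s * b = b * s) (hb' : ∀ s ∈ S, s * star b = star b * s)
    (hx : x ∈ vonNeumannGenerated S) : x * b = b * x := by
  have hbS : b ∈ StarSubalgebra.centralizer ℂ S := by
    rw [StarSubalgebra.mem_centralizer_iff]
    refine fun s hs => ⟨hb s hs, ?_⟩
    have h2 := congrArg star (hb' s hs)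
    simpa only [star_mul, star_star] using h2.symm
  exact (((StarSubalgebra.mem_centralizer_iff ℂ).1
    (show x ∈ StarSubalgebra.centralizer ℂ
      (StarSubalgebra.centralizer ℂ S : Set (K →L[ℂ] K)) from hx) b hbS).1).symm

variable {G : Type*} [Group G]

theorem leftTranslation_apply {K : Type v} [NormedAddCommGroup K] [InnerProductSpace ℂ K]
    (g : G) (f : lp (fun _ : G => K) 2) (k : G) :
    leftTranslation K g f k = f (g⁻¹ * k) := rfl

theorem leftTranslation_single {K : Type v} [NormedAddCommGroup K] [InnerProductSpace ℂ K]
    [DecidableEq G] (g k : G) (a : K) :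
    leftTranslation K g (lp.single 2 k a) = lp.single 2 (g * k) a := by
  refine lp.ext (funext fun m => ?_)
  rw [leftTranslation_apply, lp.single_apply, lp.single_apply, Pi.single_apply, Pi.single_apply]
  simp only [inv_mul_eq_iff_eq_mul]

theorem star_leftTranslation (g : G) :
    star (leftTranslation K g) = leftTranslation K g⁻¹ := by
  have h1 : leftTranslation K g * leftTranslation K g⁻¹ = 1 :=
    ContinuousLinearMap.ext fun f => lp.ext (funext fun k => by
      change f (g⁻¹⁻¹ * (g⁻¹ * k)) = f k
      rw [inv_inv, mul_inv_cancel_left])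
  have h2 : star (leftTranslation K g) * leftTranslation K g = 1 :=
    (ContinuousLinearMap.norm_map_iff_adjoint_comp_self _).1 fun f => by
      rw [leftTranslation, LinearIsometry.coe_toContinuousLinearMap, LinearIsometry.norm_map]
  exact left_inv_eq_right_inv h2 h1

variable {N : VonNeumannAlgebra K}

theorem SpatialAction.embed_apply (α : SpatialAction G N) (x : K →L[ℂ] K)
    (f : lp (fun _ : G => K) 2) (k : G) : α.embed x f k = α.act k⁻¹ x (f k) := rfl

theorem SpatialAction.act_eq_self (α : SpatialAction G N) {g : G} (hg : α.implementing g = 1)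
    (x : K →L[ℂ] K) : α.act g x = x := by
  refine ContinuousLinearMap.ext fun v => ?_
  change α.implementing g (x ((α.implementing g).symm v)) = x v
  rw [hg]
  rfl

theorem SpatialAction.embed_single_one [DecidableEq G] (α : SpatialAction G N) (x : K →L[ℂ] K)
    (a : K) : α.embed x (lp.single 2 1 a) = lp.single 2 1 (x a) := by
  refine lp.ext (funext fun k => ?_)
  rw [embed_apply]
  by_cases hk : k = 1
  · subst hk
    rw [lp.single_apply_self, lp.single_apply_self, inv_one,
      α.act_eq_self (map_one α.implementing)]
  · rw [lp.single_apply_ne _ _ _ hk, lp.single_apply_ne _ _ _ hk, map_zero]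

/-- The operator `1 ⊗ b` on `ℓ²(G, K)`, which applies `b` to each component. -/
def amplification {K : Type v} [NormedAddCommGroup K] [InnerProductSpace ℂ K] (G : Type*)
    (b : K →L[ℂ] K) : lp (fun _ : G => K) 2 →L[ℂ] lp (fun _ : G => K) 2 :=
  lp.mapCLM 2 (fun _ : G => b) (norm_nonneg b) fun _ => le_rfl

theorem amplification_apply {K : Type v} [NormedAddCommGroup K] [InnerProductSpace ℂ K]
    {G : Type*} (b : K →L[ℂ] K) (f : lp (fun _ : G => K) 2) (k : G) :
    amplification G b f k = b (f k) := rfl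

theorem star_amplification {G : Type*} {b : K →L[ℂ] K} (hb : star b = b) :
    star (amplification G b) = amplification G b := by
  refine ContinuousLinearMap.ext fun f => ext_inner_left ℂ fun g => ?_
  rw [ContinuousLinearMap.star_eq_adjoint, ContinuousLinearMap.adjoint_inner_right,
    lp.inner_eq_tsum, lp.inner_eq_tsum]
  refine tsum_congr fun k => ?_
  rw [amplification_apply, amplification_apply, ← ContinuousLinearMap.adjoint_inner_right,
    ← ContinuousLinearMap.star_eq_adjoint, hb]

/-- If the self-adjoint operator `b` lies in `N'`, then `1 ⊗ b` lies in `(N ⋊ G)'`. -/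
theorem mul_amplification_of_mem_crossedProduct (α : SpatialAction G N) {b : K →L[ℂ] K}
    (hb : star b = b) (hN : ∀ y ∈ N, y * b = b * y) {x : lp (fun _ : G => K) 2 →L[ℂ] _}
    (hx : x ∈ crossedProduct α) : x * amplification G b = amplification G b * x := by
  have key : ∀ s ∈ α.embed '' (N : Set (K →L[ℂ] K)) ∪ Set.range (leftTranslation (G := G) K),
      s * amplification G b = amplification G b * s := by
    rintro _ (⟨y, hy, rfl⟩ | ⟨g, rfl⟩)
    · refine ContinuousLinearMap.ext fun f => lp.ext (funext fun k => ?_)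
      exact congrArg (fun T : K →L[ℂ] K => T (f k)) (hN _ (α.conj_mem k⁻¹ y hy))
    · rfl
  exact mul_comm_of_mem_vonNeumannGenerated key (by rwa [star_amplification hb]) hx

theorem leftTranslation_mem_crossedProduct (α : SpatialAction G N) (g : G) :
    leftTranslation K g ∈ crossedProduct α :=
  subset_vonNeumannGenerated (Or.inr ⟨g, rfl⟩)

theorem SpatialAction.embed_mem_crossedProduct (α : SpatialAction G N) {y : K →L[ℂ] K}
    (hy : y ∈ N) : α.embed y ∈ crossedProduct α :=
  subset_vonNeumannGenerated (Or.inl ⟨y, hy, rfl⟩)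

/-- For a commutative group, the translation by an element acting trivially commutes with the whole
crossed product. -/
theorem leftTranslation_mem_commutant {G : Type*} [CommGroup G] (α : SpatialAction G N) {g : G}
    (hg : α.implementing g = 1) : leftTranslation K g ∈ (crossedProduct α).commutant := by
  have key : ∀ h : G, α.implementing h = 1 →
      ∀ s ∈ α.embed '' (N : Set (K →L[ℂ] K)) ∪ Set.range (leftTranslation (G := G) K),
        s * leftTranslation K h = leftTranslation K h * s := by
    rintro h hh _ (⟨y, _, rfl⟩ | ⟨k, rfl⟩)
    · refine ContinuousLinearMap.ext fun f => lp.ext (funext fun k => ?_)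
      change α.act k⁻¹ y (f (h⁻¹ * k)) = α.act (h⁻¹ * k)⁻¹ y (f (h⁻¹ * k))
      have h1 : α.implementing (h⁻¹ * k)⁻¹ = α.implementing k⁻¹ := by
        rw [mul_inv_rev, inv_inv, map_mul, hh, mul_one]
      rw [SpatialAction.act, SpatialAction.act, h1]
    · refine ContinuousLinearMap.ext fun f => lp.ext (funext fun m => ?_)
      change f (h⁻¹ * (k⁻¹ * m)) = f (k⁻¹ * (h⁻¹ * m))
      rw [mul_left_comm]
  rw [VonNeumannAlgebra.mem_commutant_iff]
  intro x hx
  refine mul_comm_of_mem_vonNeumannGenerated (key g hg) ?_ hx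
  -- The adjoint of `λ_g` is the translation by `g⁻¹`, which acts trivially as well.
  rw [star_leftTranslation]
  exact key g⁻¹ (by rw [map_inv, hg, inv_one])

/-- If a commutative group acts through a unitary representation with a nontrivial kernel, then the
crossed product has the corresponding translation as a nonscalar central element. -/
theorem implementing_injective_of_isFactor {G : Type*} [CommGroup G] [Nontrivial K]
    (α : SpatialAction G N) (h : IsFactor (crossedProduct α)) :
    Function.Injective α.implementing := by
  classical
  rw [injective_iff_map_eq_one]
  intro g hg
  by_contra hne
  obtain ⟨c, hc⟩ := h _ (leftTranslation_mem_crossedProduct α g)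
    (leftTranslation_mem_commutant α hg)
  -- `λ_g` moves `δ₁ ⊗ v` to `δ_g ⊗ v`, so it is not a scalar.
  obtain ⟨v, hv⟩ := exists_ne (0 : K)
  have h1 := congrArg (fun T : lp (fun _ : G => K) 2 →L[ℂ] lp (fun _ : G => K) 2 =>
    T (lp.single 2 1 v) g) hc
  change leftTranslation K g (lp.single 2 1 v) g =
    c • (lp.single 2 (1 : G) v : lp (fun _ : G => K) 2) g at h1
  rw [leftTranslation_single, mul_one, lp.single_apply_self, lp.single_apply_ne _ _ _ hne,
    smul_zero] at h1
  exact hv h1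

end CrossedProduct

/-! ### Complexification -/

section Complexification

namespace Complexification

variable {H : Type u} [NormedAddCommGroup H]

theorem norm_ofReal (ξ : H) : ‖ofReal ξ‖ = ‖ξ‖ :=
  (sq_eq_sq₀ (norm_nonneg _) (norm_nonneg _)).1 (by simp [norm_sq, ofReal])

variable [InnerProductSpace ℝ H]

theorem inner_ofReal (ξ ζ : H) :
    inner ℂ (ofReal ξ) (ofReal ζ) = ((inner ℝ ξ ζ : ℝ) : ℂ) := by
  apply Complex.ext <;> simp [inner_def, ofReal]

theorem eq_ofReal_add (ξ : Complexification H) :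
    ξ = ofReal ξ.re + Complex.I • ofReal ξ.im :=
  ext (by simp [ofReal]) (by simp [ofReal])

end Complexification

end Complexification

/-! ### Left and right creation operators on the full Fock space -/

section Fock

variable {E : Type u} [NormedAddCommGroup E] [InnerProductSpace ℂ E]

theorem inner_algCons (ξ ζ : E) (n : ℕ) (x y : AlgPower E n) :
    inner ℂ (algCons ξ n x) (algCons ζ n y) = inner ℂ ξ ζ * inner ℂ x y :=
  TensorProduct.inner_tmul (𝕜 := ℂ) ξ ζ x y

theorem inner_cons (ξ ζ : E) (n : ℕ) (x y : HilbertPower E n) :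
    inner ℂ (cons ξ n x) (cons ζ n y) = inner ℂ ξ ζ * inner ℂ x y := by
  induction x, y using UniformSpace.Completion.induction_on₂ with
  | hp => exact isClosed_eq (by fun_prop) (by fun_prop)
  | ih x y =>
    rw [cons, cons, complMap_coe, complMap_coe, UniformSpace.Completion.inner_coe,
      UniformSpace.Completion.inner_coe, inner_algCons]

theorem inner_creation (ξ ζ : E) (f g : Fock E) :
    inner ℂ (creation ξ f) (creation ζ g) = inner ℂ ξ ζ * inner ℂ f g := by
  refine (lp.hasSum_inner (creation ξ f) (creation ζ g)).unique ?_
  rw [← hasSum_nat_add_iff' 1]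
  have h := (lp.hasSum_inner f g).mul_left (inner ℂ ξ ζ)
  have h0 : ∑ i ∈ Finset.range 1, inner ℂ (creation ξ f i) (creation ζ g i) = 0 := by
    rw [Finset.sum_range_one]
    exact inner_zero_left _
  rw [h0, sub_zero]
  exact h.congr_fun fun n => inner_cons ξ ζ n (f n) (g n)

/-- The relation `ℓ(ξ)* ℓ(ζ) = ⟨ξ, ζ⟩ 1`. -/
theorem star_creation_creation (ξ ζ : E) (f : Fock E) :
    star (creation ξ) (creation ζ f) = inner ℂ ξ ζ • f := by
  refine ext_inner_left ℂ fun g => ?_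
  rw [ContinuousLinearMap.star_eq_adjoint, ContinuousLinearMap.adjoint_inner_right,
    inner_creation, inner_smul_right]

theorem star_creation_mul_self (e : E) (he : ‖e‖ = 1) :
    star (creation e) * creation e = 1 := by
  refine ContinuousLinearMap.ext fun f => ?_
  change star (creation e) (creation e f) = f
  rw [star_creation_creation, inner_self_eq_norm_sq_to_K, he]
  simp

theorem star_creation_vacuum (ξ : E) : star (creation ξ) (vacuum : Fock E) = 0 := by
  refine ext_inner_left ℂ fun g => ?_
  rw [ContinuousLinearMap.star_eq_adjoint, ContinuousLinearMap.adjoint_inner_right, vacuum,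
    lp.inner_single_right, inner_zero_right]
  exact inner_zero_left _

theorem inner_vacuum_vacuum : inner ℂ (vacuum : Fock E) vacuum = 1 := by
  rw [vacuum, lp.inner_single_left, lp.single_apply_self, UniformSpace.Completion.inner_coe]
  change inner ℂ (EuclideanSpace.single PUnit.unit (1 : ℂ) : EuclideanSpace ℂ PUnit)
    (EuclideanSpace.single PUnit.unit 1) = 1
  simp

theorem creation_single (ξ : E) (n : ℕ) (x : AlgPower E n) :
    creation ξ (lp.single 2 n (x : HilbertPower E n)) =
      lp.single 2 (n + 1) ((algCons ξ n x : AlgPower E (n + 1)) : HilbertPower E (n + 1)) := by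
  apply lp.ext
  funext m
  change creationFun ξ _ m = _
  cases m with
  | zero => rw [lp.single_apply_ne _ _ _ (by omega)]; rfl
  | succ m =>
    change cons ξ m _ = _
    by_cases hm : m = n
    · subst hm
      rw [lp.single_apply_self, lp.single_apply_self, cons, complMap_coe]
    · rw [lp.single_apply_ne _ _ _ hm, lp.single_apply_ne _ _ _ (by omega), map_zero]

/-- A closed subspace of an `ℓ²`-direct sum that contains every vector supported in a single
summand is everything. -/
theorem mem_of_single_mem {ι : Type*} [DecidableEq ι] {V : ι → Type*}
    [∀ i, NormedAddCommGroup (V i)] [∀ i, NormedSpace ℂ (V i)] {T : Submodule ℂ (lp V 2)}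
    (hT : IsClosed (T : Set (lp V 2))) (h : ∀ i a, lp.single 2 i a ∈ T) (f : lp V 2) : f ∈ T :=
  hT.mem_of_tendsto (lp.hasSum_single (by norm_num) f)
    (Eventually.of_forall fun s => T.sum_mem fun i _ => h i (f i))

theorem fock_mem_of_single_coe_mem {T : Submodule ℂ (Fock E)} (hT : IsClosed (T : Set (Fock E)))
    (h : ∀ n (x : AlgPower E n), lp.single 2 n (x : HilbertPower E n) ∈ T) (f : Fock E) :
    f ∈ T := by
  refine mem_of_single_mem hT (fun n a => ?_) f
  induction a using UniformSpace.Completion.induction_on with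
  | hp => exact hT.preimage (lp.isometry_single n).continuous
  | ih x => exact h n x

theorem exists_smul_algVacuum (x : AlgPower E 0) : ∃ c : ℂ, x = c • algVacuum :=
  ⟨(show EuclideanSpace ℂ PUnit from x) PUnit.unit, by
    refine PiLp.ext (p := 2) fun i => ?_
    change _ = _ * (EuclideanSpace.single PUnit.unit (1 : ℂ) : EuclideanSpace ℂ PUnit) i
    simp⟩

/-- `x ↦ x ⊗ e`, from `E^{⊗_alg n}` to `E^{⊗_alg (n + 1)}`, for a unit vector `e`. The recursion
follows `AlgPower`, whose tensor factors are added on the left; the normalisation `‖e‖ = 1` makes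
each step an isometry, so that the tensor product of isometries can be used. -/
def algSnoc (e : E) (he : ‖e‖ = 1) : (n : ℕ) → (AlgPower E n →ₗᵢ[ℂ] AlgPower E (n + 1))
  | 0 => ⟨(algCons e 0).toLinearMap, fun x => by
      change ‖algCons e 0 x‖ = _
      rw [norm_algCons, he, one_mul]⟩
  | n + 1 => (TensorProduct.mapIsometry LinearIsometry.id (algSnoc e he n) :
      (E ⊗[ℂ] AlgPower E n) →ₗᵢ[ℂ] (E ⊗[ℂ] AlgPower E (n + 1)))

theorem algSnoc_algCons (e : E) (he : ‖e‖ = 1) (ξ : E) (n : ℕ) (x : AlgPower E n) :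
    algSnoc e he (n + 1) (algCons ξ n x) = algCons ξ (n + 1) (algSnoc e he n x) := rfl

/-- `x ↦ x ⊗ e`, from `E^{⊗ n}` to `E^{⊗ (n + 1)}`, for a unit vector `e`. -/
def snoc (e : E) (he : ‖e‖ = 1) (n : ℕ) : HilbertPower E n →L[ℂ] HilbertPower E (n + 1) :=
  complMap (algSnoc e he n).toContinuousLinearMap

theorem norm_snoc (e : E) (he : ‖e‖ = 1) (n : ℕ) (x : HilbertPower E n) :
    ‖snoc e he n x‖ = ‖x‖ := by
  rw [snoc, norm_complMap_apply _ 1 (fun y => ?_) x, one_mul]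
  rw [one_mul]
  exact (algSnoc e he n).norm_map y

theorem snoc_coe (e : E) (he : ‖e‖ = 1) (n : ℕ) (x : AlgPower E n) :
    snoc e he n (x : HilbertPower E n) = (algSnoc e he n x : HilbertPower E (n + 1)) :=
  complMap_coe _ x

theorem snoc_cons (e : E) (he : ‖e‖ = 1) (ξ : E) (n : ℕ) (x : HilbertPower E n) :
    snoc e he (n + 1) (cons ξ n x) = cons ξ (n + 1) (snoc e he n x) := by
  induction x using UniformSpace.Completion.induction_on with
  | hp => exact isClosed_eq (by fun_prop) (by fun_prop)
  | ih x => rw [cons, cons, complMap_coe, snoc_coe, snoc_coe, complMap_coe, algSnoc_algCons]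

/-- The components of `r(e) f`: the component in degree `0` vanishes, and the component in
degree `n + 1` is `f n ⊗ e`. -/
def rightCreationFun (e : E) (he : ‖e‖ = 1) (f : (n : ℕ) → HilbertPower E n) :
    (n : ℕ) → HilbertPower E n
  | 0 => 0
  | n + 1 => snoc e he n (f n)

theorem hasSum_rightCreationFun (e : E) (he : ‖e‖ = 1) (f : Fock E) :
    HasSum (fun n => ‖rightCreationFun e he f n‖ ^ (2 : ℝ≥0∞).toReal)
      (‖f‖ ^ (2 : ℝ≥0∞).toReal) := by
  have h := lp.hasSum_norm (p := 2) (by norm_num) f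
  rw [hasSum_nat_add_iff' 1 |>.symm]
  simpa [rightCreationFun, norm_snoc] using h

/-- The right creation operator `r(e)` of a unit vector `e`, as a linear isometry. -/
def rightCreationIsometry (e : E) (he : ‖e‖ = 1) : Fock E →ₗᵢ[ℂ] Fock E :=
    { toFun := fun f =>
        ⟨rightCreationFun e he f, memℓp_gen (hasSum_rightCreationFun e he f).summable⟩
      map_add' := fun f g => by
        apply lp.ext
        funext n
        cases n with
        | zero => exact (add_zero _).symm
        | succ n => exact map_add (snoc e he n) _ _
      map_smul' := fun c f => by
        apply lp.ext
        funext n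
        cases n with
        | zero => exact (smul_zero c).symm
        | succ n => exact map_smul (snoc e he n) c _
      norm_map' := fun f => by
        have h := (lp.hasSum_norm (p := 2) (by norm_num)
          (⟨rightCreationFun e he f, memℓp_gen (hasSum_rightCreationFun e he f).summable⟩ :
            Fock E)).unique (hasSum_rightCreationFun e he f)
        exact (Real.rpow_left_inj (norm_nonneg _) (norm_nonneg _) (by norm_num)).1 h }

/-- The right creation operator `r(e)` of a unit vector `e`: `r(e) Ω = e` and
`r(e)(ξ₁ ⊗ ⋯ ⊗ ξₙ) = ξ₁ ⊗ ⋯ ⊗ ξₙ ⊗ e`. -/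
def rightCreation (e : E) (he : ‖e‖ = 1) : Fock E →L[ℂ] Fock E :=
  (rightCreationIsometry e he).toContinuousLinearMap

theorem star_rightCreation_mul_self (e : E) (he : ‖e‖ = 1) :
    star (rightCreation e he) * rightCreation e he = 1 :=
  (ContinuousLinearMap.norm_map_iff_adjoint_comp_self _).1
    (rightCreationIsometry e he).norm_map

theorem creation_mul_rightCreation (e : E) (he : ‖e‖ = 1) (ξ : E) :
    creation ξ * rightCreation e he = rightCreation e he * creation ξ := by
  refine ContinuousLinearMap.ext fun f => lp.ext (funext fun n => ?_)
  change creationFun ξ (rightCreationFun e he f) n = rightCreationFun e he (creationFun ξ f) n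
  match n with
  | 0 => rfl
  | 1 => exact (map_zero (cons ξ 0)).trans (map_zero (snoc e he 0)).symm
  | n + 2 => exact (snoc_cons e he ξ n (f n)).symm

theorem rightCreation_vacuum (e : E) (he : ‖e‖ = 1) :
    rightCreation e he vacuum = creation e (vacuum : Fock E) := by
  refine lp.ext (funext fun n => ?_)
  match n with
  | 0 => rfl
  | 1 =>
    change snoc e he 0 _ = cons e 0 _
    rw [vacuum, lp.single_apply_self, snoc_coe, cons, complMap_coe]
    rfl
  | n + 2 =>
    change snoc e he (n + 1) _ = cons e (n + 1) _
    rw [vacuum, lp.single_apply_ne _ _ _ (by omega), map_zero, map_zero]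

theorem star_rightCreation_vacuum (e : E) (he : ‖e‖ = 1) :
    star (rightCreation e he) (vacuum : Fock E) = 0 := by
  refine ext_inner_left ℂ fun g => ?_
  rw [ContinuousLinearMap.star_eq_adjoint, ContinuousLinearMap.adjoint_inner_right, vacuum,
    lp.inner_single_right, inner_zero_right]
  exact inner_zero_left _

end Fock

/-! ### Left and right semicircular operators -/

section Semicircular

variable {H : Type u} [NormedAddCommGroup H] [InnerProductSpace ℝ H]

theorem algCons_eq_real_add (ξ : Complexification H) (n : ℕ) (x : AlgPower (Complexification H) n) :
    algCons ξ n x = algCons (.ofReal ξ.re) n x + Complex.I • algCons (.ofReal ξ.im) n x := by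
  conv_lhs => rw [ξ.eq_ofReal_add]
  exact (TensorProduct.add_tmul _ _ _).trans
    (congrArg _ (TensorProduct.smul_tmul' _ _ _).symm)

/-- The vacuum is cyclic for the creation operators of the vectors of the real space `H`: a closed
complex subspace that contains `Ω` and is invariant under these operators is everything. -/
theorem fock_induction {T : Submodule ℂ (Fock (Complexification H))}
    (hT : IsClosed (T : Set (Fock (Complexification H)))) (hvac : vacuum ∈ T)
    (hcr : ∀ (ξ : H), ∀ f ∈ T, creation (.ofReal ξ) f ∈ T) (f : Fock (Complexification H)) :
    f ∈ T := by
  refine fock_mem_of_single_coe_mem hT (fun n => ?_) f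
  induction n with
  | zero =>
    intro x
    obtain ⟨c, rfl⟩ := exists_smul_algVacuum x
    rw [UniformSpace.Completion.coe_smul, lp.single_smul]
    exact T.smul_mem c hvac
  | succ n ih =>
    intro x
    induction x using algPower_succ_induction with
    | zero => rw [UniformSpace.Completion.coe_zero, lp.single_zero]; exact T.zero_mem
    | cons ξ y =>
      rw [algCons_eq_real_add, UniformSpace.Completion.coe_add, UniformSpace.Completion.coe_smul,
        lp.single_add, lp.single_smul, ← creation_single, ← creation_single]
      exact T.add_mem (hcr _ _ (ih y)) (T.smul_mem _ (hcr _ _ (ih y)))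
    | add x y hx hy =>
      rw [UniformSpace.Completion.coe_add, lp.single_add]
      exact T.add_mem hx hy

local notation "ℱ" => Fock (Complexification H)

variable (H) in
/-- The orthogonal projection `P_Ω` onto `ℂ Ω`. -/
def vacuumProjection : ℱ →L[ℂ] ℱ := (innerSL ℂ (vacuum : ℱ)).smulRight vacuum

theorem vacuumProjection_apply (f : ℱ) :
    vacuumProjection H f = (inner ℂ (vacuum : ℱ) f) • vacuum := rfl

theorem star_vacuumProjection : star (vacuumProjection H) = vacuumProjection H := by
  refine ContinuousLinearMap.ext fun f => ext_inner_left ℂ fun g => ?_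
  rw [ContinuousLinearMap.star_eq_adjoint, ContinuousLinearMap.adjoint_inner_right,
    vacuumProjection_apply, vacuumProjection_apply, inner_smul_left, inner_smul_right,
    inner_conj_symm, mul_comm]

theorem eq_of_eq_creation {A B : ℱ →L[ℂ] ℱ} (hvac : A vacuum = B vacuum)
    (hcr : ∀ (ξ : H) f, A (creation (.ofReal ξ) f) = B (creation (.ofReal ξ) f)) : A = B :=
  ContinuousLinearMap.ext fun f =>
    fock_induction (T := LinearMap.eqLocus (A : ℱ →ₗ[ℂ] ℱ) (B : ℱ →ₗ[ℂ] ℱ))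
      (isClosed_eq A.continuous B.continuous) hvac (fun ξ f _ => hcr ξ f) f

/-- The relation `ℓ(ξ)* r(e) = r(e) ℓ(ξ)* + ⟨ξ, e⟩ P_Ω`: the two operators commute except on the
vacuum, where the letter created on the right is the one annihilated on the left. -/
theorem star_creation_mul_rightCreation (ξ e : Complexification H) (he : ‖e‖ = 1) :
    star (creation ξ) * rightCreation e he =
      rightCreation e he * star (creation ξ) + inner ℂ ξ e • vacuumProjection H := by
  have happ : ∀ (ζ : Complexification H) f, rightCreation e he (creation ζ f) =
      creation ζ (rightCreation e he f) := fun ζ f =>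
    (congrArg (fun T : ℱ →L[ℂ] ℱ => T f) (creation_mul_rightCreation e he ζ)).symm
  refine eq_of_eq_creation ?_ fun ζ f => ?_
  · change star (creation ξ) (rightCreation e he vacuum) =
      rightCreation e he (star (creation ξ) vacuum) + inner ℂ ξ e • vacuumProjection H vacuum
    rw [rightCreation_vacuum, star_creation_creation, star_creation_vacuum, map_zero, zero_add,
      vacuumProjection_apply, inner_vacuum_vacuum, one_smul]
  · change star (creation ξ) (rightCreation e he (creation (.ofReal ζ) f)) =
      rightCreation e he (star (creation ξ) (creation (.ofReal ζ) f)) +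
        inner ℂ ξ e • vacuumProjection H (creation (.ofReal ζ) f)
    rw [happ, star_creation_creation, star_creation_creation, map_smul, vacuumProjection_apply,
      ← ContinuousLinearMap.adjoint_inner_left, ← ContinuousLinearMap.star_eq_adjoint,
      star_creation_vacuum, inner_zero_left, zero_smul, smul_zero, add_zero]

theorem star_rightCreation_mul_creation (ξ e : Complexification H) (he : ‖e‖ = 1) :
    star (rightCreation e he) * creation ξ =
      creation ξ * star (rightCreation e he) + inner ℂ e ξ • vacuumProjection H := by
  have h := congrArg star (star_creation_mul_rightCreation ξ e he)
  rwa [star_mul, star_star, star_add, star_mul, star_star, star_smul, star_vacuumProjection,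
    Complex.star_def, inner_conj_symm] at h

/-- The right semicircular operator `d(e) = r(e) + r(e)*` of a unit vector `e` of the real Hilbert
space `H`. -/
def rightSemicircular (e : H) (he : ‖e‖ = 1) : ℱ →L[ℂ] ℱ :=
  rightCreation (Complexification.ofReal e) ((Complexification.norm_ofReal e).trans he) +
    star (rightCreation (Complexification.ofReal e) ((Complexification.norm_ofReal e).trans he))

theorem star_rightSemicircular (e : H) (he : ‖e‖ = 1) :
    star (rightSemicircular e he) = rightSemicircular e he := by
  rw [rightSemicircular, star_add, star_star, add_comm]

/-- Left and right semicircular operators commute: `s(ξ) d(e) - d(e) s(ξ)` is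
`(⟨ξ, e⟩ - ⟨e, ξ⟩) P_Ω`, and inner products of vectors of `H` are real. -/
theorem semicircular_mul_rightSemicircular (ξ e : H) (he : ‖e‖ = 1) :
    semicircular ξ * rightSemicircular e he = rightSemicircular e he * semicircular ξ := by
  have he' := (Complexification.norm_ofReal e).trans he
  have h1 := creation_mul_rightCreation (Complexification.ofReal e) he' (.ofReal ξ)
  have h2 := star_creation_mul_rightCreation (Complexification.ofReal ξ) (.ofReal e) he'
  have h3 := star_rightCreation_mul_creation (Complexification.ofReal ξ) (.ofReal e) he'
  have h4 := congrArg star h1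
  rw [star_mul, star_mul] at h4
  rw [Complexification.inner_ofReal] at h2 h3
  rw [real_inner_comm] at h3
  simp only [semicircular, rightSemicircular, add_mul, mul_add]
  rw [h1, h2, h3, h4]
  abel

theorem semicircular_vacuum (ξ : H) : semicircular ξ vacuum = creation (.ofReal ξ) vacuum := by
  change creation (Complexification.ofReal ξ) vacuum +
    star (creation (Complexification.ofReal ξ)) vacuum = _
  rw [star_creation_vacuum, add_zero]

theorem rightSemicircular_vacuum (e : H) (he : ‖e‖ = 1) :
    rightSemicircular e he vacuum = semicircular e vacuum := by
  rw [semicircular_vacuum]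
  change rightCreation _ _ vacuum + star (rightCreation _ _) vacuum = _
  rw [star_rightCreation_vacuum, add_zero, rightCreation_vacuum]

/-- The vacuum is cyclic for the semicircular operators. If `T` is invariant under them, then
`{f ∈ T | ∀ ξ, ℓ(ξ)* f ∈ T}` is invariant under `ℓ(ξ) = s(ξ) - ℓ(ξ)*`. -/
theorem fock_induction_semicircular {T : Submodule ℂ ℱ} (hT : IsClosed (T : Set ℱ))
    (hvac : vacuum ∈ T) (hs : ∀ (ξ : H), ∀ f ∈ T, semicircular ξ f ∈ T) (f : ℱ) : f ∈ T := by
  let S : Submodule ℂ ℱ :=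
    { carrier := {f | f ∈ T ∧ ∀ ξ : H, star (creation (Complexification.ofReal ξ)) f ∈ T}
      zero_mem' := ⟨T.zero_mem, fun ξ => by rw [map_zero]; exact T.zero_mem⟩
      add_mem' := fun {f g} hf hg => ⟨T.add_mem hf.1 hg.1, fun ξ => by
        rw [map_add]; exact T.add_mem (hf.2 ξ) (hg.2 ξ)⟩
      smul_mem' := fun c f hf => ⟨T.smul_mem c hf.1, fun ξ => by
        rw [map_smul]; exact T.smul_mem c (hf.2 ξ)⟩ }
  have hS : IsClosed (S : Set ℱ) := by
    have h : (S : Set ℱ) = (T : Set ℱ) ∩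
        ⋂ ξ : H, (star (creation (Complexification.ofReal ξ)) : ℱ →L[ℂ] ℱ) ⁻¹' (T : Set ℱ) := by
      ext f
      rw [Set.mem_inter_iff, Set.mem_iInter]
      rfl
    rw [h]
    exact hT.inter (isClosed_iInter fun ξ => hT.preimage (ContinuousLinearMap.continuous _))
  refine (fock_induction (T := S) hS ⟨hvac, fun ξ => ?_⟩ (fun ξ g hg => ⟨?_, fun ζ => ?_⟩) f).1
  · rw [star_creation_vacuum]
    exact T.zero_mem
  · have h : creation (.ofReal ξ) g = semicircular ξ g - star (creation (.ofReal ξ)) g :=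
      (add_sub_cancel_right _ _).symm
    rw [h]
    exact T.sub_mem (hs ξ g hg.1) (hg.2 ξ)
  · rw [star_creation_creation]
    exact T.smul_mem _ hg.1

/-- The isometry `ℓ(e)` is pure: `ℓ(e)*` lowers the degree, so `(ℓ(e)*)ⁿ → 0` strongly. -/
theorem tendsto_star_creation_pow (e : Complexification H) (he : ‖e‖ = 1) (f : ℱ) :
    Tendsto (fun n : ℕ => (star (creation e) ^ n) f) atTop (𝓝 0) := by
  let T : Submodule ℂ ℱ :=
    { carrier := {f | Tendsto (fun n : ℕ => (star (creation e) ^ n) f) atTop (𝓝 0)}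
      zero_mem' := by simp
      add_mem' := fun {f g} hf hg => by
        simpa only [Set.mem_ofPred_eq, map_add, add_zero] using Tendsto.add hf hg
      smul_mem' := fun c f hf => by
        simpa only [Set.mem_ofPred_eq, map_smul, smul_zero] using Tendsto.const_smul hf c }
  have hT : IsClosed (T : Set ℱ) := by
    refine isClosed_of_closure_subset fun f hf => ?_
    change Tendsto _ _ _
    rw [Metric.tendsto_atTop]
    intro ε hε
    obtain ⟨g, hg, hfg⟩ := Metric.mem_closure_iff.1 hf (ε / 2) (half_pos hε)
    obtain ⟨N, hN⟩ := Metric.tendsto_atTop.1 (show Tendsto _ _ _ from hg) (ε / 2) (half_pos hε)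
    refine ⟨N, fun n hn => ?_⟩
    have h1 := hN n hn
    rw [dist_zero_right] at h1 ⊢
    have h2 := norm_star_pow_apply_le (star_creation_mul_self e he) n (f - g)
    rw [map_sub] at h2
    rw [dist_eq_norm] at hfg
    have h3 := norm_le_norm_sub_add ((star (creation e) ^ n) f) ((star (creation e) ^ n) g)
    linarith
  refine fock_induction (T := T) hT ?_ (fun ξ g hg => ?_) f
  · change Tendsto _ _ _
    rw [← tendsto_add_atTop_iff_nat 1]
    refine tendsto_const_nhds.congr fun n => ?_
    rw [pow_succ]
    change 0 = (star (creation e) ^ n) (star (creation e) vacuum)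
    rw [star_creation_vacuum, map_zero]
  · change Tendsto _ _ _
    rw [← tendsto_add_atTop_iff_nat 1]
    have h := Tendsto.const_smul (show Tendsto _ _ _ from hg) (inner ℂ e (.ofReal ξ))
    rw [smul_zero] at h
    refine h.congr fun n => ?_
    rw [pow_succ]
    change _ = (star (creation e) ^ n) (star (creation e) (creation (.ofReal ξ) g))
    rw [star_creation_creation, map_smul]

theorem creation_eq_rightCreation {e' e : H} (he' : ‖e'‖ = 1) (he : ‖e‖ = 1) {η : ℱ}
    (h : semicircular e' η = rightSemicircular e he η) :
    creation (.ofReal e') η =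
      rightCreation (.ofReal e) ((Complexification.norm_ofReal e).trans he) η :=
  intertwiner_of_semicircular_eq
    (star_creation_mul_self _ ((Complexification.norm_ofReal e').trans he'))
    (star_rightCreation_mul_self _ _) (creation_mul_rightCreation _ _ _)
    (tendsto_star_creation_pow _ ((Complexification.norm_ofReal e').trans he')) h

theorem star_creation_eq_star_rightCreation {e' e : H} (he' : ‖e'‖ = 1) (he : ‖e‖ = 1) {η : ℱ}
    (h : semicircular e' η = rightSemicircular e he η) :
    star (creation (.ofReal e')) η =
      star (rightCreation (.ofReal e) ((Complexification.norm_ofReal e).trans he)) η := by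
  have h1 := creation_eq_rightCreation he' he h
  change creation (.ofReal e') η + star (creation (.ofReal e')) η =
    rightCreation _ _ η + star (rightCreation _ _) η at h
  rw [h1] at h
  exact add_left_cancel h

/-- From `η = ℓ(e')* ℓ(e') η = ℓ(e')* r(e) η = r(e) ℓ(e')* η + ⟨e', e⟩ ⟨Ω, η⟩ Ω`, pairing with `Ω`
gives `⟨Ω, η⟩ = ⟨e', e⟩ ⟨Ω, η⟩`, where `⟨e', e⟩ ≠ 1`. -/
theorem inner_vacuum_eq_zero {e' e : H} (he' : ‖e'‖ = 1) (he : ‖e‖ = 1) (hne : e' ≠ e) {η : ℱ}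
    (h : semicircular e' η = rightSemicircular e he η) : inner ℂ (vacuum : ℱ) η = 0 := by
  have hE := (Complexification.norm_ofReal e).trans he
  have h1 : star (creation (.ofReal e')) (creation (.ofReal e') η) = η :=
    congrArg (fun T : ℱ →L[ℂ] ℱ => T η)
      (star_creation_mul_self _ ((Complexification.norm_ofReal e').trans he'))
  rw [creation_eq_rightCreation he' he h] at h1
  have h2 := congrArg (fun T : ℱ →L[ℂ] ℱ => T η)
    (star_creation_mul_rightCreation (.ofReal e') (.ofReal e) hE)
  change star (creation (.ofReal e')) (rightCreation (.ofReal e) hE η) =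
    rightCreation (.ofReal e) hE (star (creation (.ofReal e')) η) +
      inner ℂ (Complexification.ofReal e') (.ofReal e) • vacuumProjection H η at h2
  rw [h1] at h2
  have h3 := congrArg (inner ℂ (vacuum : ℱ)) h2
  rw [inner_add_right, ← ContinuousLinearMap.adjoint_inner_left,
    ← ContinuousLinearMap.star_eq_adjoint, star_rightCreation_vacuum, inner_zero_left, zero_add,
    inner_smul_right, vacuumProjection_apply, inner_smul_right, inner_vacuum_vacuum, mul_one,
    Complexification.inner_ofReal] at h3
  by_contra h0
  have h4 : ((inner ℝ e' e : ℝ) : ℂ) = 1 :=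
    mul_right_cancel₀ h0 (h3.symm.trans (one_mul _).symm)
  exact hne ((inner_eq_one_iff_of_norm_eq_one he' he).1 (by exact_mod_cast h4))

/-- If `η ⊥ Ω`, then `η = r(e)* r(e) η = r(e)* ℓ(e') η = ℓ(e') r(e)* η = ℓ(e') ℓ(e')* η`. -/
theorem creation_star_creation_eq_self {e' e : H} (he' : ‖e'‖ = 1) (he : ‖e‖ = 1) {η : ℱ}
    (h : semicircular e' η = rightSemicircular e he η) (h0 : inner ℂ (vacuum : ℱ) η = 0) :
    creation (.ofReal e') (star (creation (.ofReal e')) η) = η := by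
  have hE := (Complexification.norm_ofReal e).trans he
  have h1 : star (rightCreation (.ofReal e) hE) (rightCreation (.ofReal e) hE η) = η :=
    congrArg (fun T : ℱ →L[ℂ] ℱ => T η) (star_rightCreation_mul_self _ hE)
  have h2 := congrArg (fun T : ℱ →L[ℂ] ℱ => T η)
    (star_rightCreation_mul_creation (.ofReal e') (.ofReal e) hE)
  change star (rightCreation (.ofReal e) hE) (creation (.ofReal e') η) =
    creation (.ofReal e') (star (rightCreation (.ofReal e) hE) η) +
      inner ℂ (Complexification.ofReal e) (.ofReal e') • vacuumProjection H η at h2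
  rw [creation_eq_rightCreation he' he h, h1, vacuumProjection_apply, h0, zero_smul, smul_zero,
    add_zero, ← star_creation_eq_star_rightCreation he' he h] at h2
  exact h2.symm

/-- The vector `η` lies in the ranges of `ℓ(V e)` and `ℓ(V f)`, which are orthogonal for `e ⊥ f`. -/
theorem eq_zero_of_forall_semicircular_eq (V : H ≃ₗᵢ[ℝ] H) {e f : H} (he : ‖e‖ = 1)
    (hf : ‖f‖ = 1) (hef : inner ℝ e f = 0) {η : ℱ} (h0 : inner ℂ (vacuum : ℱ) η = 0)
    (h : ∀ (ξ : H) (hξ : ‖ξ‖ = 1), semicircular (V ξ) η = rightSemicircular ξ hξ η) : η = 0 := by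
  have key : ∀ (ξ : H), ‖ξ‖ = 1 →
      creation (.ofReal (V ξ)) (star (creation (.ofReal (V ξ))) η) = η := fun ξ hξ =>
    creation_star_creation_eq_self ((V.norm_map ξ).trans hξ) hξ (h ξ hξ) h0
  have h1 : star (creation (.ofReal (V e))) η = 0 := by
    rw [← key f hf, star_creation_creation, Complexification.inner_ofReal, V.inner_map_map, hef,
      Complex.ofReal_zero, zero_smul]
  rw [← key e he, h1, map_zero]

/-! ### The centre of a free Bogoljubov crossed product -/

theorem mul_rightSemicircular_of_mem_gaussianAlgebra (e : H) (he : ‖e‖ = 1) {y : ℱ →L[ℂ] ℱ}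
    (hy : y ∈ gaussianAlgebra H) : y * rightSemicircular e he = rightSemicircular e he * y := by
  have key : ∀ s ∈ Set.range (semicircular (H := H)),
      s * rightSemicircular e he = rightSemicircular e he * s := by
    rintro _ ⟨ξ, rfl⟩
    exact semicircular_mul_rightSemicircular ξ e he
  exact mul_comm_of_mem_vonNeumannGenerated key (by rwa [star_rightSemicircular]) hy

theorem semicircular_mem_gaussianAlgebra (ξ : H) : semicircular ξ ∈ gaussianAlgebra H :=
  subset_vonNeumannGenerated ⟨ξ, rfl⟩

instance : Nontrivial ℱ :=
  ⟨vacuum, 0, fun h => one_ne_zero (α := ℂ) (by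
    rw [← inner_vacuum_vacuum (E := Complexification H), h, inner_zero_left])⟩

variable {G : Type*} [Group G]

theorem implementing_bogoljubovAction (π : G →* (H ≃ₗᵢ[ℝ] H)) (g : G) :
    (bogoljubovAction π).implementing g = fockHom (Complexification.mapHom (π g)) := rfl

/-- The components `η_k` of `x (δ₁ ⊗ Ω)`, for `x` central, intertwine the left and right
semicircular operators up to `π`: both `π_α(s(ξ))` and `1 ⊗ d(ξ)` commute with `x`, and they agree on
`δ₁ ⊗ Ω`. -/
theorem semicircular_apply_eq_of_central [DecidableEq G] (π : G →* (H ≃ₗᵢ[ℝ] H))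
    {x : lp (fun _ : G => ℱ) 2 →L[ℂ] lp (fun _ : G => ℱ) 2}
    (hx : x ∈ freeBogoljubovCrossedProduct π)
    (hx' : x ∈ (freeBogoljubovCrossedProduct π).commutant) (ξ : H) (hξ : ‖ξ‖ = 1) (k : G) :
    semicircular (π k⁻¹ ξ) (x (lp.single 2 1 vacuum) k) =
      rightSemicircular ξ hξ (x (lp.single 2 1 vacuum) k) := by
  set a := (bogoljubovAction π).embed (semicircular ξ)
  have h1 : a * x = x * a := VonNeumannAlgebra.mem_commutant_iff.1 hx' a
    ((bogoljubovAction π).embed_mem_crossedProduct (semicircular_mem_gaussianAlgebra ξ))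
  have h2 : x * amplification G (rightSemicircular ξ hξ) =
      amplification G (rightSemicircular ξ hξ) * x :=
    mul_amplification_of_mem_crossedProduct (bogoljubovAction π) (star_rightSemicircular ξ hξ)
      (fun y hy => mul_rightSemicircular_of_mem_gaussianAlgebra ξ hξ hy) hx
  have h3 : amplification G (rightSemicircular ξ hξ) (lp.single 2 1 vacuum) =
      a (lp.single 2 1 vacuum) := by
    rw [SpatialAction.embed_single_one, ← rightSemicircular_vacuum ξ hξ]
    refine lp.ext (funext fun m => ?_)
    rw [amplification_apply]
    by_cases hm : m = 1
    · subst hm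
      rw [lp.single_apply_self, lp.single_apply_self]
    · rw [lp.single_apply_ne _ _ _ hm, lp.single_apply_ne _ _ _ hm, map_zero]
  have h4 : a (x (lp.single 2 1 vacuum)) =
      amplification G (rightSemicircular ξ hξ) (x (lp.single 2 1 vacuum)) := by
    have e1 := congrArg (fun T : lp (fun _ : G => ℱ) 2 →L[ℂ] lp (fun _ : G => ℱ) 2 =>
      T (lp.single 2 1 vacuum)) h1
    have e2 := congrArg (fun T : lp (fun _ : G => ℱ) 2 →L[ℂ] lp (fun _ : G => ℱ) 2 =>
      T (lp.single 2 1 vacuum)) h2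
    exact e1.trans ((congrArg x h3).symm.trans e2)
  have h5 := congrArg (fun f : lp (fun _ : G => ℱ) 2 => f k) h4
  change (bogoljubovAction π).act k⁻¹ (semicircular ξ) _ = _ at h5
  rwa [bogoljubovAction_semicircular] at h5

/-- The vector `δ₁ ⊗ Ω` is cyclic for the crossed product, so an operator of the commutant is
determined by its value there. -/
theorem eq_smul_one_of_apply_single_vacuum [DecidableEq G] (π : G →* (H ≃ₗᵢ[ℝ] H))
    {x : lp (fun _ : G => ℱ) 2 →L[ℂ] lp (fun _ : G => ℱ) 2}
    (hx' : x ∈ (freeBogoljubovCrossedProduct π).commutant) {c : ℂ}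
    (hc : x (lp.single 2 1 vacuum) = c • (lp.single 2 1 vacuum : lp (fun _ : G => ℱ) 2)) :
    x = c • 1 := by
  have hcomm : ∀ y ∈ freeBogoljubovCrossedProduct π, ∀ v, x (y v) = y (x v) := fun y hy v =>
    (congrArg (fun T : lp (fun _ : G => ℱ) 2 →L[ℂ] lp (fun _ : G => ℱ) 2 => T v)
      (VonNeumannAlgebra.mem_commutant_iff.1 hx' y hy)).symm
  let W : Submodule ℂ (lp (fun _ : G => ℱ) 2) :=
    LinearMap.eqLocus (x : lp (fun _ : G => ℱ) 2 →ₗ[ℂ] lp (fun _ : G => ℱ) 2)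
      ((c • (1 : lp (fun _ : G => ℱ) 2 →L[ℂ] lp (fun _ : G => ℱ) 2) :
        lp (fun _ : G => ℱ) 2 →L[ℂ] lp (fun _ : G => ℱ) 2) :
          lp (fun _ : G => ℱ) 2 →ₗ[ℂ] lp (fun _ : G => ℱ) 2)
  have hmem : ∀ v, v ∈ W ↔ x v = c • v := fun v => Iff.rfl
  have hW : IsClosed (W : Set (lp (fun _ : G => ℱ) 2)) :=
    isClosed_eq x.continuous (continuous_const_smul c)
  have hinv : ∀ y ∈ freeBogoljubovCrossedProduct π, ∀ v ∈ W, y v ∈ W := by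
    intro y hy v hv
    rw [hmem] at hv ⊢
    rw [hcomm y hy, hv, map_smul]
  have hone : ∀ f : ℱ, (lp.single 2 1 f : lp (fun _ : G => ℱ) 2) ∈ W := by
    intro f
    refine fock_induction_semicircular
      (T := W.comap (lp.lsingle (𝕜 := ℂ) (E := fun _ : G => ℱ) 2 (1 : G))) ?_ ?_ ?_ f
    · exact hW.preimage (lp.isometry_single (E := fun _ : G => ℱ) (p := 2) (1 : G)).continuous
    · exact (hmem _).2 hc
    · intro ξ g hg
      have h := hinv _ ((bogoljubovAction π).embed_mem_crossedProduct
        (semicircular_mem_gaussianAlgebra ξ)) _ hg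
      change (bogoljubovAction π).embed (semicircular ξ) (lp.single 2 1 g) ∈ W at h
      rwa [SpatialAction.embed_single_one] at h
  refine ContinuousLinearMap.ext fun v => (hmem v).1 ?_
  refine mem_of_single_mem hW (fun g f => ?_) v
  have h := hinv _ (leftTranslation_mem_crossedProduct (bogoljubovAction π) g) _ (hone f)
  rwa [leftTranslation_single, mul_one] at h

theorem exists_norm_eq_one_apply_ne {U : H ≃ₗᵢ[ℝ] H} (hU : U ≠ 1) :
    ∃ e : H, ‖e‖ = 1 ∧ U e ≠ e := by
  obtain ⟨v, hv⟩ : ∃ v, U v ≠ v := by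
    by_contra! hall
    exact hU (LinearIsometryEquiv.ext hall)
  have hv0 : v ≠ 0 := fun h => hv (by rw [h, map_zero])
  refine ⟨(‖v‖⁻¹ : ℝ) • v, norm_smul_inv_norm hv0, fun h => hv ?_⟩
  rw [map_smul] at h
  exact smul_right_injective _ (inv_ne_zero (norm_ne_zero_iff.2 hv0)) h

theorem isFactor_of_orthonormal_pair (π : G →* (H ≃ₗᵢ[ℝ] H)) (hπ : Function.Injective π)
    {e f : H} (he : ‖e‖ = 1) (hf : ‖f‖ = 1) (hef : inner ℝ e f = 0) :
    IsFactor (freeBogoljubovCrossedProduct π) := by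
  classical
  intro x hx hx'
  have hrel := semicircular_apply_eq_of_central π hx hx'
  set η := x (lp.single 2 1 vacuum)
  refine ⟨inner ℂ vacuum (η 1), eq_smul_one_of_apply_single_vacuum π hx' ?_⟩
  refine lp.ext (funext fun k => ?_)
  change η k = inner ℂ vacuum (η 1) • (lp.single 2 (1 : G) vacuum : lp (fun _ : G => ℱ) 2) k
  by_cases hk : k = 1
  · subst hk
    rw [lp.single_apply_self, ← sub_eq_zero]
    -- `Ω` satisfies `s(ξ) Ω = d(ξ) Ω`, so its component may be subtracted from `η₁`.
    refine eq_zero_of_forall_semicircular_eq 1 he hf hef ?_ fun ξ hξ => ?_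
    · rw [inner_sub_right, inner_smul_right, inner_vacuum_vacuum, mul_one, sub_self]
    · have h := hrel ξ hξ 1
      rw [inv_one, map_one] at h
      rw [map_sub, map_sub, map_smul, map_smul, h, rightSemicircular_vacuum]
      rfl
  · rw [lp.single_apply_ne _ _ _ hk, smul_zero]
    obtain ⟨u, hu, hne⟩ := exists_norm_eq_one_apply_ne (U := π k⁻¹) fun h =>
      hk (inv_eq_one.1 (hπ (h.trans (map_one π).symm)))
    refine eq_zero_of_forall_semicircular_eq (π k⁻¹) he hf hef ?_ fun ξ hξ => hrel ξ hξ k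
    exact inner_vacuum_eq_zero (((π k⁻¹).norm_map u).trans hu) hu hne (hrel u hu k)

/-- The orthogonal group of a space of dimension at most one has exponent two. Here a unit vector
`e` with `U² e ≠ e` is not parallel to `U e`, and Gram-Schmidt applies to the pair `e, U e`. -/
theorem exists_orthonormal_pair_of_mul_self_ne_one (U : H ≃ₗᵢ[ℝ] H) (hU : U * U ≠ 1) :
    ∃ e f : H, ‖e‖ = 1 ∧ ‖f‖ = 1 ∧ inner ℝ e f = 0 := by
  obtain ⟨e, he, hUe⟩ := exists_norm_eq_one_apply_ne hU
  change U (U e) ≠ e at hUe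
  set t : ℝ := inner ℝ e (U e)
  set w : H := U e - t • e
  have hee : inner ℝ e e = (1 : ℝ) := by rw [real_inner_self_eq_norm_sq, he, one_pow]
  have hw : w ≠ 0 := by
    intro hw
    have h1 : U e = t • e := sub_eq_zero.1 hw
    have h2 : ‖t‖ = 1 := by
      have := congrArg norm h1
      rw [U.norm_map, norm_smul, he, mul_one] at this
      exact this.symm
    have h3 : t * t = 1 := by
      rw [Real.norm_eq_abs] at h2
      rw [← abs_mul_abs_self, h2, one_mul]
    exact hUe (by rw [h1, map_smul, h1, smul_smul, h3, one_smul])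
  refine ⟨e, (‖w‖⁻¹ : ℝ) • w, he, norm_smul_inv_norm hw, ?_⟩
  rw [inner_smul_right, inner_sub_right, inner_smul_right, hee, mul_one, sub_self, mul_zero]

end Semicircular

end FreeBogoljubov

end

theorem mainTheorem11 {H : Type*} [NormedAddCommGroup H] [InnerProductSpace ℝ H] [CompleteSpace H]
    (π : Multiplicative ℤ →* (H ≃ₗᵢ[ℝ] H)) :
    FreeBogoljubov.IsFactor (FreeBogoljubov.freeBogoljubovCrossedProduct π) ↔
      Function.Injective π := by
  refine ⟨fun h a b hab => ?_, fun hπ => ?_⟩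
  · have hinj := FreeBogoljubov.implementing_injective_of_isFactor
      (FreeBogoljubov.bogoljubovAction π) h
    refine hinj ?_
    rw [FreeBogoljubov.implementing_bogoljubovAction,
      FreeBogoljubov.implementing_bogoljubovAction, hab]
  · have h2 : π (Multiplicative.ofAdd 1) * π (Multiplicative.ofAdd 1) ≠ 1 := fun h => by
      rw [← map_mul, ← map_one π] at h
      have h11 : (1 : ℤ) + 1 = 0 := hπ h
      exact absurd h11 (by norm_num)
    obtain ⟨e, f, he, hf, hef⟩ :=
      FreeBogoljubov.exists_orthonormal_pair_of_mul_self_ne_one _ h2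
    exact FreeBogoljubov.isFactor_of_orthonormal_pair π hπ he hf hef
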